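/- Let $\Omega$ be an arbitrary set, and let $\mathcal{J}(\Omega)$ be the monoid of all injective functions $\Omega\to\Omega$ under composition. For $s,t\in\mathcal{J}(\Omega)$ write $s\sim_s^1 t$ if there exist an integer $n\ge 1$, elements $p_1,\dots,p_n\in\mathcal{J}(\Omega)$ and a permutation $f$ of $\{1,\dots,n\}$ such that $s=p_1\cdots p_n$ and $t=p_{f(1)}\cdots p_{f(n)}$, and let $\sim_s$ be the transitive closure of $\sim_s^1$. Let $s,t\in\mathcal{J}(\Omega)$. If $\Omega$ is infinite, then $s\sim_s t$ if and only if $|\Omega\setminus s(\Omega)|=|\Omega\setminus t(\Omega)|$ (equality of cardinal numbers). If $\Omega$ is finite, and hence $\mathcal{J}(\Omega)$ is the group of all permutations of $\Omega$, then $s\sim_s t$ if and only if $st^{-1}$ is an even permutation. -/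

import Mathlib

/-- One-step symmetric (permutation) conjugacy in a monoid `M`: `s = p₁ ⋯ pₙ` and
`t = p_{f(1)} ⋯ p_{f(n)}` for some `n ≥ 1`, some `p₁, …, pₙ ∈ M` and some permutation `f` of the
indices. (For a monoid `M`, adjoining an identity is understood to give `M` itself.) -/
def SymConjStep {M : Type*} [Monoid M] (s t : M) : Prop :=
  ∃ n : ℕ, 0 < n ∧ ∃ (p : Fin n → M) (f : Equiv.Perm (Fin n)),
    s = (List.ofFn p).prod ∧ (List.ofFn fun i => p (f i)).prod = t

/-- Symmetric (permutation) conjugacy: the transitive closure of the one-step relation. -/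
def SymConj {M : Type*} [Monoid M] : M → M → Prop :=
  Relation.TransGen SymConjStep

/-- The monoid of all injective functions from `Ω` to `Ω`, with composition as multiplication. -/
def InjMonoid (Ω : Type*) : Submonoid (Function.End Ω) where
  carrier := {f | Function.Injective f}
  mul_mem' := fun hf hg => Function.Injective.comp hf hg
  one_mem' := Function.injective_id

/-- The underlying function `Ω → Ω` of an element of `InjMonoid Ω`. -/
def injToFun {Ω : Type*} (s : InjMonoid Ω) : Ω → Ω := s.1

/-- For finite `Ω`, an injective self-map of `Ω`, regarded as a permutation of `Ω`. -/
noncomputable def injToPerm {Ω : Type*} [Finite Ω] (s : InjMonoid Ω) : Equiv.Perm Ω :=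
  Equiv.ofBijective (injToFun s) (Finite.injective_iff_bijective.mp s.2)

theorem coe_injToPerm {Ω : Type*} [Finite Ω] (s : InjMonoid Ω) :
    ⇑(injToPerm s) = injToFun s := rfl

/-!
Symmetric conjugacy is invariant under every homomorphism to a commutative monoid
(`SymConj.map_eq`). The two invariants are the cardinality of the complement of the range, which is
additive under composition (`defectHom`), and, for finite `Ω`, the sign.

Conversely, for a homomorphism `ι` from a group `G` to the monoid, multiplying by `ι g` with `g` in
the commutator subgroup of `G` does not change the class (`SymConj.of_mem_commutator`): the factors
of `a b a⁻¹ b⁻¹ m` can be reordered as `a a⁻¹ b b⁻¹ m = m`. This is applied to the group of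
permutations of `Ω`.

* For infinite `Ω`, two injections whose ranges have equinumerous complements differ by a
  permutation (`exists_equiv_extending`), and the symmetric group is perfect
  (`Equiv.Perm.mem_commutator_of_infinite`). A permutation fixing a set of full cardinality pointwise
  is a commutator by a swindle: move it to level `0` of `Ω × ℤ`, where it is the quotient of the
  permutation acting on all levels `n ≥ 0` by its shift. Any permutation `p` agrees on a set of full
  cardinality with some `q` which in turn is the identity on a set of full cardinality, so both `q`
  and `q⁻¹ * p` are commutators.
* For finite `Ω`, the alternating group is generated by 3-cycles, and a 3-cycle is a commutator since
  it is conjugate to its square.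
-/

/-! ### Symmetric conjugacy in monoids -/

theorem SymConjStep.symm {M : Type*} [Monoid M] {s t : M} (h : SymConjStep s t) :
    SymConjStep t s := by
  obtain ⟨n, hn, p, f, rfl, rfl⟩ := h
  exact ⟨n, hn, fun i => p (f i), f⁻¹, rfl, by simp⟩

theorem SymConj.symm {M : Type*} [Monoid M] {s t : M} (h : SymConj s t) : SymConj t s := by
  induction h with
  | single h => exact .single h.symm
  | tail _ h ih => exact .head h.symm ih

theorem SymConj.refl {M : Type*} [Monoid M] (s : M) : SymConj s s :=
  .single ⟨1, one_pos, fun _ => s, 1, by simp, by simp⟩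

theorem SymConj.map_eq {M N : Type*} [Monoid M] [CommMonoid N] (φ : M →* N) {s t : M}
    (h : SymConj s t) : φ s = φ t := by
  have step : ∀ {s t : M}, SymConjStep s t → φ s = φ t := by
    rintro _ _ ⟨n, -, p, f, rfl, rfl⟩
    simp only [map_list_prod, List.map_ofFn, List.prod_ofFn, Function.comp_apply]
    exact (Equiv.prod_comp f fun i => φ (p i)).symm
  induction h with
  | single h => exact step h
  | tail _ h ih => exact ih.trans (step h)

theorem SymConj.of_mem_commutator {G M : Type*} [Group G] [Monoid M] (ι : G →* M) {g : G}
    (hg : g ∈ commutator G) (m : M) : SymConj (ι g * m) m := by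
  rw [commutator_eq_closure] at hg
  induction hg using Subgroup.closure_induction generalizing m with
  | mem g hg =>
    obtain ⟨a, b, rfl⟩ := hg
    refine .single ⟨5, by norm_num, ![ι a, ι b, ι a⁻¹, ι b⁻¹, m], Equiv.swap 1 2, ?_, ?_⟩
    · simp [List.ofFn_succ, commutatorElement_def, mul_assoc]
    · have h1 : (Equiv.swap 1 2 : Equiv.Perm (Fin 5)) 0 = 0 := by decide
      have h2 : (Equiv.swap 1 2 : Equiv.Perm (Fin 5)) 3 = 3 := by decide
      have h3 : (Equiv.swap 1 2 : Equiv.Perm (Fin 5)) 4 = 4 := by decide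
      have e : (fun i => ![ι a, ι b, ι a⁻¹, ι b⁻¹, m] (Equiv.swap 1 2 i)) =
          ![ι a, ι a⁻¹, ι b, ι b⁻¹, m] := by
        funext i
        fin_cases i <;> simp [h1, h2, h3]
      rw [e]
      simp [List.ofFn_succ, ← mul_assoc, ← map_mul]
  | one => simpa using SymConj.refl m
  | mul x y _ _ hx hy =>
    rw [map_mul, mul_assoc]
    exact (hx (ι y * m)).trans (hy m)
  | inv x _ hx =>
    have := hx (ι x⁻¹ * m)
    rw [← mul_assoc, ← map_mul, mul_inv_cancel, map_one, one_mul] at this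
    exact this.symm

/-! ### Perfectness of infinite symmetric groups -/

/-- The partial bijection `f c ↦ g c` extends to a bijection as soon as the complements of its domain
and of its image are equinumerous. -/
theorem exists_equiv_extending {α β γ : Type*} {f : γ → α} {g : γ → β}
    (hf : Function.Injective f) (hg : Function.Injective g)
    (h : Nonempty (↥(Set.range f)ᶜ ≃ ↥(Set.range g)ᶜ)) :
    ∃ e : α ≃ β, ∀ c, e (f c) = g c := by
  classical
  obtain ⟨k⟩ := h
  refine ⟨(Equiv.Set.sumCompl (Set.range f)).symm.trans ((Equiv.sumCongr
    ((Equiv.ofInjective f hf).symm.trans (Equiv.ofInjective g hg)) k).trans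
      (Equiv.Set.sumCompl (Set.range g))), fun c => ?_⟩
  have : (Equiv.ofInjective f hf).symm ⟨f c, c, rfl⟩ = c := Equiv.ofInjective_symm_apply hf c
  simp [Equiv.Set.sumCompl_symm_apply_of_mem (Set.mem_range_self c), this]

open Cardinal in
/-- Sets containing a subset of full cardinality in two equinumerous types are equinumerous. -/
theorem nonempty_equiv_of_subset_of_mk_le {α β : Type*} {s E : Set α}
    {t E' : Set β} (h : Nonempty (α ≃ β)) (hE : #α ≤ #E) (hs : E ⊆ s)
    (hE' : #β ≤ #E') (ht : E' ⊆ t) : Nonempty (s ≃ t) := by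
  obtain ⟨e⟩ := h
  obtain ⟨a⟩ := Cardinal.eq.1 (le_antisymm (mk_set_le s) (hE.trans (mk_le_mk_of_subset hs)))
  obtain ⟨b⟩ := Cardinal.eq.1 (le_antisymm (mk_set_le t) (hE'.trans (mk_le_mk_of_subset ht)))
  exact ⟨(a.trans e).trans b.symm⟩

open Cardinal in
theorem nonempty_equiv_prod_countable {Ω : Type*} [Infinite Ω] (κ : Type) [Countable κ]
    [Nonempty κ] : Nonempty (Ω ≃ Ω × κ) := by
  refine Cardinal.eq.1 ?_
  rw [mk_prod, lift_uzero]
  exact (mul_eq_left (aleph0_le_mk Ω)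
    ((lift_le_aleph0.2 mk_le_aleph0).trans (aleph0_le_mk Ω)) (by simp)).symm

open Cardinal commutatorElement in
/-- The swindle: identify `Ω` with `Ω × ℤ` so that `p` acts on level `0` only. Then `p` is the
commutator of the permutation acting as `p` on all nonnegative levels and the shift of levels. -/
theorem Equiv.Perm.mem_commutator_of_fixes {Ω : Type*} [Infinite Ω] (p : Equiv.Perm Ω) (F : Set Ω)
    (hF : #Ω ≤ #F) (hp : ∀ x ∈ F, p x = x) : p ∈ commutator (Equiv.Perm Ω) := by
  obtain ⟨e, he⟩ : ∃ e : Ω ≃ Ω × ℤ, ∀ x : ↥Fᶜ, e x = ((x : Ω), (0 : ℤ)) := by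
    refine exists_equiv_extending (f := Subtype.val) (g := fun x : ↥Fᶜ => ((x : Ω), (0 : ℤ)))
      Subtype.val_injective (fun x y h => Subtype.ext (congrArg Prod.fst h)) ?_
    refine nonempty_equiv_of_subset_of_mk_le (E := F)
      (E' := Set.range fun x : Ω => (x, (1 : ℤ))) (nonempty_equiv_prod_countable ℤ) hF ?_ ?_ ?_
    · rw [Subtype.range_coe, compl_compl]
    · rw [mk_range_eq _ fun x y h => congrArg Prod.fst h]
      exact (Cardinal.eq.2 (nonempty_equiv_prod_countable ℤ)).ge
    · rintro _ ⟨x, rfl⟩ ⟨y, hy⟩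
      simp at hy
  let P : Equiv.Perm (Ω × ℤ) := Equiv.prodCongrLeft fun n : ℤ => if 0 ≤ n then p else 1
  let h : Equiv.Perm (Ω × ℤ) := Equiv.prodCongr (Equiv.refl Ω) (Equiv.addRight (1 : ℤ))
  have key : e.permCongrHom p = ⁅P, h⁆ := by
    rw [commutatorElement_def, eq_mul_inv_iff_mul_eq, eq_mul_inv_iff_mul_eq]
    have hconj : ∀ x n, e.permCongr p (x, n) = if n = 0 then (p x, 0) else (x, n) := by
      intro x n
      rw [Equiv.permCongr_apply]
      by_cases hy : e.symm (x, n) ∈ F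
      · rw [hp _ hy, Equiv.apply_symm_apply]
        split_ifs with hn
        · subst hn
          have hx : x ∈ F := by
            by_contra hx
            rw [← he ⟨x, hx⟩, Equiv.symm_apply_apply] at hy
            exact hx hy
          rw [hp x hx]
        · rfl
      · have h1 := he ⟨_, hy⟩
        rw [Equiv.apply_symm_apply, Prod.mk.injEq] at h1
        obtain ⟨h1, rfl⟩ := h1
        have hx : e.symm (x, 0) = x := h1.symm
        rw [hx] at hy ⊢
        rw [if_pos rfl]
        exact he ⟨p x, fun hx => hy (by rwa [p.injective (hp _ hx)] at hx)⟩
    -- Only level `0` distinguishes the nonnegative levels from their shift.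
    ext1 ⟨x, n⟩
    change e.permCongr p ((if 0 ≤ n then p else 1) x, n + 1) =
      ((if 0 ≤ n + 1 then p else 1) x, n + 1)
    rw [hconj]
    rcases lt_trichotomy n (-1) with hn | rfl | hn
    · rw [if_neg (by omega), if_neg (by omega), if_neg (by omega)]
    · simp
    · rw [if_neg (by omega), if_pos (by omega), if_pos (by omega)]
  have : p = ⁅e.permCongrHom.symm P, e.permCongrHom.symm h⁆ := by
    rw [← map_commutatorElement, ← key, MulEquiv.symm_apply_apply]
  rw [this]
  exact Subgroup.commutator_mem_commutator (Subgroup.mem_top _) (Subgroup.mem_top _)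

open Cardinal in
theorem Equiv.Perm.mem_commutator_of_infinite {Ω : Type*} [Infinite Ω] (p : Equiv.Perm Ω) :
    p ∈ commutator (Equiv.Perm Ω) := by
  obtain ⟨e⟩ := nonempty_equiv_prod_countable (Ω := Ω) (Fin 4)
  let c : Ω → Fin 4 := fun x => (e x).2
  have hc : ∀ i, #Ω ≤ #(c ⁻¹' {i}) := fun i =>
    mk_le_of_injective (f := fun x : Ω => (⟨e.symm (x, i), by simp [c]⟩ : c ⁻¹' {i}))
      fun x y hxy => by simpa using hxy
  -- `A` consists of points of colour `0` whose images under `p` all have the same colour `j`.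
  obtain ⟨⟨j⟩, A, hA0, hA, hAj⟩ := infinite_pigeonhole_set
    (fun x : c ⁻¹' {0} => ULift.up (c (p x))) #Ω (hc 0) (aleph0_le_mk Ω)
    ((lt_aleph0_of_finite _).trans_le
      (Ordinal.aleph0_le_cof_iff.2
        (Ordinal.one_lt_cof_iff.2 (isSuccLimit_ord (aleph0_le_mk Ω)))))
  have hA0' : ∀ x ∈ A, c x = 0 := fun x hx => hA0 hx
  have hAj' : ∀ x ∈ A, c (p x) = j := fun x hx => congrArg ULift.down (hAj hx)
  obtain ⟨k, l, hk0, hkj, hl0, hlj, hkl⟩ :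
      ∃ k l : Fin 4, k ≠ 0 ∧ k ≠ j ∧ l ≠ 0 ∧ l ≠ j ∧ k ≠ l := by
    clear hAj hAj'
    revert j
    decide
  -- `q` agrees with `p` on `A` and is the identity on the piece of colour `k`; the piece of colour
  -- `l` makes the complements of the domain and of the image of this partial injection large.
  obtain ⟨q, hq⟩ : ∃ q : Ω ≃ Ω, ∀ x : A ⊕ (c ⁻¹' {k} : Set Ω),
      q (Sum.elim Subtype.val Subtype.val x) = Sum.elim (fun a => p a.1) Subtype.val x := by
    refine exists_equiv_extending ?_ ?_ ?_
    · refine Subtype.val_injective.sumElim Subtype.val_injective fun a b h => hk0 ?_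
      rw [← hA0' a a.2, h]
      exact b.2.symm
    · refine (p.injective.comp Subtype.val_injective).sumElim Subtype.val_injective
        fun a b h => hkj ?_
      rw [← hAj' a a.2, show p a = b from h]
      exact b.2.symm
    · refine nonempty_equiv_of_subset_of_mk_le ⟨Equiv.refl Ω⟩ (hc l) ?_ (hc l) ?_
      · rintro _ hx ⟨a | b, rfl⟩
        · exact hl0 (hx.symm.trans (hA0' a a.2))
        · exact hkl (b.2.symm.trans hx)
      · rintro _ hx ⟨a | b, rfl⟩
        · exact hlj (hx.symm.trans (hAj' a a.2))
        · exact hkl (b.2.symm.trans hx)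
  have hq1 : q ∈ commutator (Equiv.Perm Ω) :=
    mem_commutator_of_fixes q _ (hc k) fun x hx => hq (.inr ⟨x, hx⟩)
  have hq2 : q⁻¹ * p ∈ commutator (Equiv.Perm Ω) :=
    mem_commutator_of_fixes _ A hA fun x hx => by
      rw [Equiv.Perm.mul_apply, Equiv.Perm.inv_eq_iff_eq]
      exact (hq (.inl ⟨x, hx⟩)).symm
  simpa using mul_mem hq1 hq2

/-! ### Even permutations as products of commutators -/

/-- A 3-cycle is conjugate to its square, hence it is a commutator. -/
theorem Equiv.Perm.alternatingGroup_le_commutator (Ω : Type*) [Fintype Ω] [DecidableEq Ω] :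
    alternatingGroup Ω ≤ commutator (Equiv.Perm Ω) := by
  rw [← closure_three_cycles_eq_alternating, commutator_eq_closure]
  refine Subgroup.closure_mono fun σ hσ => mem_commutatorSet_of_isConj_sq _ ?_
  rw [isConj_iff_cycleType_eq, sq]
  exact hσ.trans hσ.isThreeCycle_sq.symm

/-! ### The monoid of injections -/

/-- A permutation of `Ω`, regarded as an element of the monoid of injections. -/
def permToInj (Ω : Type*) : Equiv.Perm Ω →* InjMonoid Ω where
  toFun p := ⟨(⇑p : Ω → Ω), p.injective⟩
  map_one' := rfl
  map_mul' _ _ := rfl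

open Cardinal in
/-- The defect of an injection, that is, the cardinality of the complement of its range, as a
homomorphism to the additive monoid of cardinals. -/
def defectHom (Ω : Type*) : InjMonoid Ω →* Multiplicative Cardinal where
  toFun s := .ofAdd #↥(Set.univ \ Set.range (injToFun s))
  map_one' := by
    have : Set.range (injToFun (1 : InjMonoid Ω)) = Set.univ := Set.range_id
    simp [this]
  map_mul' s t := by
    rw [← ofAdd_add, ← mk_image_eq (s := Set.univ \ Set.range (injToFun t)) (f := injToFun s) s.2,
      ← mk_union_of_disjoint]
    · congr 3
      have hs : Function.Injective (injToFun s) := s.2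
      have : Set.range (injToFun (s * t)) = injToFun s '' Set.range (injToFun t) :=
        Set.range_comp (injToFun s) (injToFun t)
      rw [this, Set.image_sdiff hs, Set.image_univ, Set.union_comm]
      have h2 := Set.image_subset_range (injToFun s) (Set.range (injToFun t))
      ext x
      have := @h2 x
      simp only [Set.mem_sdiff, Set.mem_union, Set.mem_univ, true_and]
      tauto
    · exact Set.disjoint_left.2 fun x hx ⟨y, _, hy⟩ => hx.2 ⟨y, hy⟩

theorem symConj_iff_mk_eq {Ω : Type*} [Infinite Ω] (s t : InjMonoid Ω) :
    SymConj s t ↔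
      Cardinal.mk ↥(Set.univ \ Set.range (injToFun s)) =
        Cardinal.mk ↥(Set.univ \ Set.range (injToFun t)) := by
  refine ⟨fun h => h.map_eq (defectHom Ω), fun h => ?_⟩
  rw [← Set.compl_eq_univ_sdiff, ← Set.compl_eq_univ_sdiff] at h
  obtain ⟨u, hu⟩ := exists_equiv_extending (f := injToFun t) (g := injToFun s) t.2 s.2
    (Cardinal.eq.1 h.symm)
  have : s = permToInj Ω u * t := Subtype.ext (funext fun x => (hu x).symm)
  rw [this]
  exact .of_mem_commutator _ (Equiv.Perm.mem_commutator_of_infinite u) t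

theorem symConj_iff_sign_eq_one {Ω : Type*} [Fintype Ω] [DecidableEq Ω] (s t : InjMonoid Ω) :
    SymConj s t ↔ Equiv.Perm.sign (injToPerm s * (injToPerm t)⁻¹) = 1 := by
  constructor
  · intro h
    let φ : InjMonoid Ω →* Equiv.Perm Ω :=
      { toFun := injToPerm
        map_one' := Equiv.ext fun _ => rfl
        map_mul' := fun _ _ => Equiv.ext fun _ => rfl }
    have : Equiv.Perm.sign (injToPerm s) = Equiv.Perm.sign (injToPerm t) :=
      h.map_eq (Equiv.Perm.sign.comp φ)
    rw [map_mul, map_inv, this, mul_inv_cancel]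
  · intro h
    have hs : s = permToInj Ω (injToPerm s * (injToPerm t)⁻¹) * t :=
      Subtype.ext (funext fun x => congrArg (injToPerm s)
        ((injToPerm t).symm_apply_apply x).symm)
    rw [hs]
    exact .of_mem_commutator _ (Equiv.Perm.alternatingGroup_le_commutator Ω h) t

theorem mainTheorem3 (Ω : Type*) :
    (Infinite Ω → ∀ s t : InjMonoid Ω,
      SymConj s t ↔
        Cardinal.mk ↥(Set.univ \ Set.range (injToFun s)) =
          Cardinal.mk ↥(Set.univ \ Set.range (injToFun t))) ∧
    (∀ [Fintype Ω] [DecidableEq Ω],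
      (∀ s : Function.End Ω, s ∈ InjMonoid Ω ↔ Function.Bijective s) ∧
      ∀ s t : InjMonoid Ω,
        SymConj s t ↔ Equiv.Perm.sign (injToPerm s * (injToPerm t)⁻¹) = 1) := by
  refine ⟨fun _ => symConj_iff_mk_eq, ?_⟩
  intro _ _
  exact ⟨fun _ => Finite.injective_iff_bijective, symConj_iff_sign_eq_one⟩
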